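/- **Setting.** Let $c>0$, let $d,n$ be natural numbers, let $\mathbb{D}_c^{d}=\{u\in\mathbb{R}^d:\|u\|<1/\sqrt c\}$ be the Poincaré ball of curvature $-c$, and let $\mathbb{D}_c^{d\times n}$ be the set of $d\times n$ matrices with columns in $\mathbb{D}_c^d$. Let $\log_0^c(u)=\frac{1}{\sqrt c}\tanh^{-1}(\sqrt c\|u\|)\frac{u}{\|u\|}$, $\log_0^c(0)=0$, be the logarithmic map at the origin, applied column by column to matrices. On $\mathbb{R}^{d\times n}$, $\|\cdot\|$ is the Frobenius norm. Let $\rho$ be a Borel probability measure on $\mathbb{D}_c^{d\times n}\times\mathbb{D}_c^{d\times n}$ whose first marginal is concentrated on a set $\mathcal{X}\subseteq\mathbb{D}_c^{d\times n}$, and let $$\mathcal{E}(f)=\int\|f(x)-\log_0^c(y)\|^2\,d\rho(x,y),\qquad \mathcal{E}_D(f)=\frac1m\sum_{i=1}^m\|f(x_i)-\log_0^c(y_i)\|^2,\qquad f_\rho(x)=\int\log_0^c(y)\,d\rho(y|x),$$ where $D=((x_i,y_i))_{i\le m}$ is drawn from $\rho^{m}$. Let $\mathcal{T}$ be a class of measurable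 functions $\mathbb{D}_c^{d\times n}\to\mathbb{R}^{d\times n}$ that is pointwise separable on $\mathcal{X}$: it has a countable subset such that each $f\in\mathcal{T}$ is the pointwise limit on $\mathcal{X}$ of a sequence from that subset. For $x_1^m\in\mathcal{X}^m$ let $\mathcal{N}_1(r,\mathcal{T},x_1^m)$ be the least number of balls of radius $r$, with arbitrary functions as centres, that cover $\mathcal{T}$ in the $L^1$-distance $\frac1m\sum_{i}\sum_{j,k}|f(x_i)_{jk}-g(x_i)_{jk}|$ of the empirical measure. Write $\Delta_\rho(f)=\mathcal{E}(f)-\mathcal{E}(f_\rho)$ and $\Delta_D(f)=\mathcal{E}_D(f)-\mathcal{E}_D(f_\rho)$ for the excess risk and the empirical excess risk. **Lemma.** Let $B\ge1$, suppose $\|\log_0^c(y)\|\le B$ $\rho$-almost surely, and $\|f(x)\|\le B$ for all $f\in\mathcal{T}$ and $x\in\mathcal{X}$. (Probabilities of events that need not be measurable are outer probabilities.) 1. For all $m\ge1$, $\alpha,\beta>0$ and $\epsilon\in(0,1/2)$, $$\mathbb{P}\bigl[\exists f\in\mathcal{T}:\ \Delta_\rho(f)-\Delta_D(f)\ge\epsilon(\alpha+\beta+\Delta_\rho(f))\bigr]\le14\sup_{x_1^m\in\mathcal{X}^m}\mathcal{N}_1\Bigl(\frac{\beta\epsilon}{20B},\mathcal{T},x_1^m\Bigr)\exp\Bigl(-\frac{\epsilon^2(1-\epsilon)\alpha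 m}{214(1+\epsilon)B^4}\Bigr).$$ 2. (Rate.) For all $\theta\in(0,\frac1{2d}]$, $K>0$, and all sample sizes $m=t\ge1$ with $t^{-\theta}<1/2$, $$\mathbb{P}\bigl[\exists f\in\mathcal{T}:\ \Delta_\rho(f)-\Delta_D(f)\ge(2K+4B^2)\,t^{-\theta}\bigr]\le14\sup_{x_1^t\in\mathcal{X}^t}\mathcal{N}_1\Bigl(\frac{K t^{-\theta}}{20B},\mathcal{T},x_1^t\Bigr)\exp\Bigl(-\frac{K\,t^{1-2d\theta}}{214\,(3B^4)^d}\Bigr).$$ 3. (Almost sure rate.) Let $\theta\in(0,\frac1{2d})$, fix $c,d,B$, and for each sample size $t$ let $n_t,\mathcal{X}_t,\rho_t,\mathcal{T}_t$ be as above, with the same $B$. Suppose that for every $\delta>0$ we have $\sup_{x_1^t\in\mathcal{X}_t^t}\mathcal{N}_1(\frac{t^{-\theta}}{20B},\mathcal{T}_t,x_1^t)\le\exp(\delta\,t^{1-2d\theta})$ for all large $t$. If $D_t$, $t\in\mathbb{N}$, are random samples on one probability space, $D_t$ having law $\rho_t^{t}$ (with any dependence between different $t$), then almost surely, for all large $t$,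 every $f\in\mathcal{T}_t$ satisfies $\Delta_{\rho_t}(f)-\Delta_{D_t}(f)\le(2+4B^2)\,t^{-\theta}$. So the rate is $O(t^{-\theta})$ for every exponent $\theta<\frac{1}{2d}$. -/

import Mathlib

open MeasureTheory ProbabilityTheory Filter Topology
open scoped ENNReal

/-- The Poincaré ball of curvature `-c`: the points of `ℝ^d` of norm less than `1 / √c`
(for `c > 0`). -/
abbrev PoincareBall (c : ℝ) (d : ℕ) : Type :=
  {x : EuclideanSpace ℝ (Fin d) // c * ‖x‖ ^ 2 < 1}

theorem isOpen_poincareBall (c : ℝ) (d : ℕ) :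
    IsOpen {x : EuclideanSpace ℝ (Fin d) | c * ‖x‖ ^ 2 < 1} :=
  isOpen_lt (by fun_prop) continuous_const

theorem mem_poincareBall_iff {c : ℝ} (hc : 0 < c) {d : ℕ} (x : EuclideanSpace ℝ (Fin d)) :
    c * ‖x‖ ^ 2 < 1 ↔ ‖x‖ < 1 / Real.sqrt c := by
  have hs : 0 < Real.sqrt c := Real.sqrt_pos.2 hc
  rw [lt_div_iff₀ hs, ← sq_lt_one_iff₀ (a := ‖x‖ * Real.sqrt c) (by positivity), mul_pow,
    Real.sq_sqrt hc.le, mul_comm]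

instance (c : ℝ) (d : ℕ) : Nonempty (PoincareBall c d) :=
  ⟨⟨0, by simp⟩⟩

instance (c : ℝ) (d : ℕ) : StandardBorelSpace (PoincareBall c d) :=
  (isOpen_poincareBall c d).measurableSet.standardBorel

/-- `𝔻_c^{d × n}`: sequences of `n` tokens in the `d`-dimensional Poincaré ball, i.e. `d × n`
matrices whose columns lie in the ball. -/
abbrev TokenSeq (c : ℝ) (d n : ℕ) : Type := Fin n → PoincareBall c d

/-- `ℝ^{d × n}` with the Euclidean (Frobenius) norm. -/
abbrev Mat (d n : ℕ) : Type := EuclideanSpace ℝ (Fin d × Fin n)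

/-- The logarithmic map at the origin of the Poincaré ball,
`log_0^c(y) = (1/√c) artanh(√c ‖y‖) y / ‖y‖` for `y ≠ 0`, and `log_0^c(0) = 0`. -/
noncomputable def logZero (c : ℝ) {d : ℕ} (y : PoincareBall c d) : EuclideanSpace ℝ (Fin d) :=
  (1 / Real.sqrt c * Real.artanh (Real.sqrt c * ‖y.1‖) / ‖y.1‖) • y.1

/-- The logarithmic map applied to each column. -/
noncomputable def logSeq (c : ℝ) {d n : ℕ} (y : TokenSeq c d n) : Mat d n :=
  WithLp.toLp 2 fun p => logZero c (y p.2) p.1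

/-- The hyperbolic regression function `f_ρ(x) = ∫ log_0^c(y) dρ(y | x)`. -/
noncomputable def regressionFun {c : ℝ} {d n : ℕ}
    (ρ : ProbabilityMeasure (TokenSeq c d n × TokenSeq c d n)) (x : TokenSeq c d n) : Mat d n :=
  ∫ y, logSeq c y ∂((ρ : Measure (TokenSeq c d n × TokenSeq c d n)).condKernel x)

/-- The generalization error `∫ ‖f(x) - log_0^c(y)‖² dρ(x, y)`. -/
noncomputable def risk {c : ℝ} {d n : ℕ}
    (ρ : ProbabilityMeasure (TokenSeq c d n × TokenSeq c d n)) (f : TokenSeq c d n → Mat d n) : ℝ :=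
  ∫ z, ‖f z.1 - logSeq c z.2‖ ^ 2 ∂(ρ : Measure (TokenSeq c d n × TokenSeq c d n))

/-- The empirical risk of `f` on the sample `z_1, …, z_m`. -/
noncomputable def empRisk {c : ℝ} {d n m : ℕ} (z : Fin m → TokenSeq c d n × TokenSeq c d n)
    (f : TokenSeq c d n → Mat d n) : ℝ :=
  (1 / (m : ℝ)) * ∑ i, ‖f (z i).1 - logSeq c (z i).2‖ ^ 2

/-- The excess risk over the regression function. -/
noncomputable def excessRisk {c : ℝ} {d n : ℕ}
    (ρ : ProbabilityMeasure (TokenSeq c d n × TokenSeq c d n)) (f : TokenSeq c d n → Mat d n) : ℝ :=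
  risk ρ f - risk ρ (regressionFun ρ)

/-- The empirical excess risk over the regression function. -/
noncomputable def empExcessRisk {c : ℝ} {d n m : ℕ}
    (ρ : ProbabilityMeasure (TokenSeq c d n × TokenSeq c d n))
    (z : Fin m → TokenSeq c d n × TokenSeq c d n) (f : TokenSeq c d n → Mat d n) : ℝ :=
  empRisk z f - empRisk z (regressionFun ρ)

/-- The distance of `f` and `g` in `L¹` of the empirical measure of `x_1, …, x_m`, where
`ℝ^{d × n}` carries the norm `∑ |v_j|`. -/
noncomputable def empL1Dist {c : ℝ} {d n m : ℕ} (x : Fin m → TokenSeq c d n)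
    (f g : TokenSeq c d n → Mat d n) : ℝ :=
  (1 / (m : ℝ)) * ∑ i, ∑ p, |f (x i) p - g (x i) p|

/-- The empirical covering number `𝒩₁(r, T, x_1^m)`: the least number of balls of radius `r` in
`L¹` of the empirical measure (centred at arbitrary functions) that cover `T`; `⊤` if there is no
finite cover. -/
noncomputable def coveringNumber {c : ℝ} {d n m : ℕ} (r : ℝ)
    (T : Set (TokenSeq c d n → Mat d n)) (x : Fin m → TokenSeq c d n) : ℕ∞ :=
  ⨅ (G : Finset (TokenSeq c d n → Mat d n)) (_ : ∀ f ∈ T, ∃ g ∈ G, empL1Dist x f g < r),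
    (G.card : ℕ∞)

/-- `sup_{x_1^m ∈ 𝒳^m} 𝒩₁(r, T, x_1^m)`. -/
noncomputable def supCoveringNumber {c : ℝ} {d n : ℕ} (m : ℕ) (r : ℝ)
    (X : Set (TokenSeq c d n)) (T : Set (TokenSeq c d n → Mat d n)) : ℝ≥0∞ :=
  ⨆ (x : Fin m → TokenSeq c d n) (_ : ∀ i, x i ∈ X), (coveringNumber r T x).toENNReal

/-- A class of functions is pointwise separable on `X` if it has a countable subset whose
sequential pointwise limits on `X` exhaust the class. -/
def PointwiseSeparable {c : ℝ} {d n : ℕ} (X : Set (TokenSeq c d n))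
    (T : Set (TokenSeq c d n → Mat d n)) : Prop :=
  ∃ S : Set (TokenSeq c d n → Mat d n), S ⊆ T ∧ S.Countable ∧
    ∀ f ∈ T, ∃ u : ℕ → TokenSeq c d n → Mat d n, (∀ k, u k ∈ S) ∧
      ∀ x ∈ X, Tendsto (fun k => u k x) atTop (𝓝 (f x))

/-- The bounded regression setting: under `ρ` the input lies in `X` and the target `log_0^c(y)` is
bounded by `B`; `T` is a pointwise separable class of measurable functions bounded by `B`
on `X`. -/
structure BoundedRegression {c : ℝ} {d n : ℕ} (B : ℝ) (X : Set (TokenSeq c d n))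
    (ρ : ProbabilityMeasure (TokenSeq c d n × TokenSeq c d n))
    (T : Set (TokenSeq c d n → Mat d n)) : Prop where
  input_mem : ∀ᵐ z ∂(ρ : Measure (TokenSeq c d n × TokenSeq c d n)), z.1 ∈ X
  target_le : ∀ᵐ z ∂(ρ : Measure (TokenSeq c d n × TokenSeq c d n)), ‖logSeq c z.2‖ ≤ B
  measurable : ∀ f ∈ T, Measurable f
  bounded : ∀ f ∈ T, ∀ x ∈ X, ‖f x‖ ≤ B
  separable : PointwiseSeparable X T

/-- The law `ρ^m` of `m` independent draws from `ρ`. -/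
noncomputable def sampleLaw {c : ℝ} {d n : ℕ}
    (ρ : ProbabilityMeasure (TokenSeq c d n × TokenSeq c d n)) (m : ℕ) :
    Measure (Fin m → TokenSeq c d n × TokenSeq c d n) :=
  Measure.pi fun _ => (ρ : Measure (TokenSeq c d n × TokenSeq c d n))

/-!
Write `g_f(x, y) = ‖f(x) - log_0^c(y)‖² - ‖f_ρ(x) - log_0^c(y)‖²` for the excess loss, so that
`Δ_ρ(f) = ∫ g_f dρ` and `Δ_D(f)` is the mean `P_m g_f` of `g_f` over the sample. As `f_ρ` is a
conditional mean, `∫ g_f = ∫ ‖f - f_ρ‖²`, whence the variance condition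
`∫ g_f² ≤ 16 B² ∫ g_f` (`BoundedRegression.integral_excessLoss_sq_le`).

The event in the tail bound says that `(1 - ε) ∫ g_f - P_m g_f ≥ ε (α + β)` for some `f`. With
`κ = ε / (64 B²)`, the variance condition gives `ε ∫ g_f ≥ 2 κ ∫ g_f²`, and therefore
`(1 - ε) ∫ g_f - P_m g_f ≤ (∫ h_f - P_m h_f) - κ (∫ g_f² + P_m g_f²)` for `h_f = g_f - κ g_f²`.
The right side is a centred process with a negative quadratic offset. Its exponential moment,
uniformly over the class, is symmetrized directly
(`lintegral_iSup_exp_le_sum_offsetExp`): Jensen's inequality introduces a ghost sample, each pair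
of sample and ghost sample point is swapped at random, and the two samples decouple. What remains
is `exp (κ ∑ (σₖ h_f(zₖ) - κ g_f(zₖ)²))` with random signs `σ` on a fixed sample. For a single
`f` the average over the signs is at most `1`, because `cosh u ≤ exp (u² / 2)` and the offset
compensates the quadratic term (`sum_offsetExp_le`); a union bound over a net of the class in `L¹`
of the empirical measure brings in the covering number (`sum_iSup_offsetExp_le`). Markov's
inequality then yields `BoundedRegression.sampleLaw_deviation_le`, with `128 B²` in place of the
larger `214 (1 + ε) B⁴ / (1 - ε)` and without the factor `14`. Pointwise separability reduces the
uncountable supremum to a countable, measurable one.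

The rate is the case `α = β = K`, `ε = t ^ (-θ)`, as `Δ_ρ(f) ≤ 4 B²`, and the almost sure rate
follows by Borel–Cantelli (`ae_eventually_deviation_le`), since half of the exponent suffices to
absorb the covering numbers and `exp (-δ t ^ γ)` is summable for `γ = 1 - 2 d θ > 0`.
-/

/-! ### Rademacher averages with a quadratic offset -/

/-- The sign `±1` encoded by a Boolean. -/
def boolSign (b : Bool) : ℝ := if b then 1 else -1

/-- The exponential weight `exp (κ ∑ₖ (σₖ (aₖ - κ aₖ²) - κ aₖ²))` of a vector `a` and a vector of
signs `σ`; the second square is the offset that pays for the fluctuation of the signed sum. -/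
noncomputable def offsetExp {m : ℕ} (κ : ℝ) (a : Fin m → ℝ) (σ : Fin m → Bool) : ℝ :=
  Real.exp (κ * ∑ k, (boolSign (σ k) * (a k - κ * a k ^ 2) - κ * a k ^ 2))

/-- Averaged over all signs, a single vector has offset weight at most `1`: the bound
`cosh x ≤ exp (x² / 2)` is absorbed by the offset. -/
theorem sum_offsetExp_le {m : ℕ} {κ : ℝ} (a : Fin m → ℝ)
    (ha : ∀ k, |κ * a k| ≤ 1 / 4) : ∑ σ, offsetExp κ a σ ≤ 2 ^ m := by
  have h1 : ∀ σ : Fin m → Bool, offsetExp κ a σ =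
      ∏ k, Real.exp (κ * (boolSign (σ k) * (a k - κ * a k ^ 2) - κ * a k ^ 2)) := fun σ => by
    rw [offsetExp, Finset.mul_sum, Real.exp_sum]
  simp_rw [h1]
  rw [← Fintype.piFinset_univ, ← Finset.prod_univ_sum (fun _ => Finset.univ)
    (fun k (b : Bool) => Real.exp (κ * (boolSign b * (a k - κ * a k ^ 2) - κ * a k ^ 2)))]
  calc _ ≤ ∏ _k : Fin m, (2 : ℝ) := by
        refine Finset.prod_le_prod (fun k _ => Finset.sum_nonneg fun b _ => (Real.exp_pos _).le)
          fun k _ => ?_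
        have h2 : Real.cosh (κ * (a k - κ * a k ^ 2)) ≤ Real.exp (κ ^ 2 * a k ^ 2) := by
          refine (Real.cosh_le_exp_half_sq _).trans (Real.exp_le_exp.2 ?_)
          have := abs_le.1 (ha k)
          have h3 : (1 - κ * a k) ^ 2 ≤ 2 := by nlinarith
          have h4 := mul_le_mul_of_nonneg_left h3 (sq_nonneg (κ * a k))
          nlinarith
        calc _ = 2 * (Real.cosh (κ * (a k - κ * a k ^ 2)) * Real.exp (-(κ ^ 2 * a k ^ 2))) := by
              rw [Fintype.sum_bool, Real.cosh_eq, div_mul_eq_mul_div, mul_div_cancel₀ _ two_ne_zero,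
                add_mul, ← Real.exp_add, ← Real.exp_add]
              congr 2 <;> simp [boolSign] <;> ring
          _ ≤ 2 * (Real.exp (κ ^ 2 * a k ^ 2) * Real.exp (-(κ ^ 2 * a k ^ 2))) := by gcongr
          _ = 2 := by rw [← Real.exp_add]; simp
    _ = 2 ^ m := by simp

/-- Replacing a vector by a nearby one changes its offset weight by a controlled factor. -/
theorem offsetExp_le_of_sum_abs_sub_le {m : ℕ} {κ δ : ℝ} (hκ : 0 ≤ κ) {a b : Fin m → ℝ}
    (ha : ∀ k, |κ * a k| ≤ 1 / 32) (hb : ∀ k, |κ * b k| ≤ 1 / 32)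
    (hab : ∑ k, |a k - b k| ≤ δ) (σ : Fin m → Bool) :
    offsetExp κ a σ ≤ offsetExp κ b σ * Real.exp (κ * (9 / 8 * δ)) := by
  rw [offsetExp, offsetExp, ← Real.exp_add, Real.exp_le_exp, ← mul_add]
  refine mul_le_mul_of_nonneg_left ?_ hκ
  have h : ∀ k, boolSign (σ k) * (a k - κ * a k ^ 2) - κ * a k ^ 2 ≤
      (boolSign (σ k) * (b k - κ * b k ^ 2) - κ * b k ^ 2) + 9 / 8 * |a k - b k| := fun k => by
    have h1 : |κ * a k + κ * b k| ≤ 1 / 16 := by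
      refine (abs_add_le _ _).trans ?_
      linarith [ha k, hb k]
    have h2 : |κ * a k ^ 2 - κ * b k ^ 2| ≤ 1 / 16 * |a k - b k| := by
      rw [show κ * a k ^ 2 - κ * b k ^ 2 = (κ * a k + κ * b k) * (a k - b k) by ring, abs_mul]
      exact mul_le_mul_of_nonneg_right h1 (abs_nonneg _)
    have h3 := abs_le.1 h2
    have h4 := le_abs_self (a k - b k)
    have h5 := neg_abs_le (a k - b k)
    cases σ k <;> simp only [boolSign] <;> norm_num <;> linarith
  calc _ ≤ ∑ k, ((boolSign (σ k) * (b k - κ * b k ^ 2) - κ * b k ^ 2) + 9 / 8 * |a k - b k|) :=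
        Finset.sum_le_sum fun k _ => h k
    _ ≤ _ := by
        rw [Finset.sum_add_distrib, ← Finset.mul_sum]
        linarith

/-- Union bound over a finite net: the offset weights of a family of vectors that is covered by
`c.card` of its members have sign average of their supremum at most `c.card`, up to the factor
for the width of the net. -/
theorem sum_iSup_offsetExp_le {ι : Type*} {m : ℕ} {κ δ : ℝ} (hκ : 0 ≤ κ) (a : ι → Fin m → ℝ)
    (c : Finset ι) (ha : ∀ i k, |κ * a i k| ≤ 1 / 32)
    (hc : ∀ i, ∃ j ∈ c, ∑ k, |a i k - a j k| ≤ δ) :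
    ∑ σ, ⨆ i, ENNReal.ofReal (offsetExp κ (a i) σ) ≤
      2 ^ m * (c.card * ENNReal.ofReal (Real.exp (κ * (9 / 8 * δ)))) := by
  have hpos : ∀ i σ, 0 ≤ offsetExp κ (a i) σ := fun i σ => (Real.exp_pos _).le
  calc _ ≤ ∑ σ, ∑ j ∈ c, ENNReal.ofReal (offsetExp κ (a j) σ) *
          ENNReal.ofReal (Real.exp (κ * (9 / 8 * δ))) := by
        refine Finset.sum_le_sum fun σ _ => iSup_le fun i => ?_
        obtain ⟨j, hj, hij⟩ := hc i
        refine le_trans ?_ (Finset.single_le_sum (f := fun j => ENNReal.ofReal (offsetExp κ (a j) σ) *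
          ENNReal.ofReal (Real.exp (κ * (9 / 8 * δ)))) (fun _ _ => zero_le) hj)
        rw [← ENNReal.ofReal_mul (hpos j σ)]
        exact ENNReal.ofReal_le_ofReal (offsetExp_le_of_sum_abs_sub_le hκ (ha i) (ha j) hij σ)
    _ = ∑ j ∈ c, ENNReal.ofReal (∑ σ, offsetExp κ (a j) σ) *
          ENNReal.ofReal (Real.exp (κ * (9 / 8 * δ))) := by
        rw [Finset.sum_comm]
        refine Finset.sum_congr rfl fun j _ => ?_
        rw [← Finset.sum_mul, ENNReal.ofReal_sum_of_nonneg fun σ _ => hpos j σ]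
    _ ≤ ∑ j ∈ c, 2 ^ m * ENNReal.ofReal (Real.exp (κ * (9 / 8 * δ))) := by
        refine Finset.sum_le_sum fun j _ => ?_
        gcongr
        refine ENNReal.ofReal_le_of_le_toReal ?_
        simpa using sum_offsetExp_le (a j) fun k => (ha j k).trans (by norm_num)
    _ = _ := by rw [Finset.sum_const, nsmul_eq_mul]; ring

/-! ### Symmetrization -/

/-- Jensen's inequality for a ghost sample `z'`. The variance condition trades `ε ∫ g` for
`2 κ ∫ g²`, which becomes the offset on both samples. -/
theorem exp_sum_le_lintegral_ghost {Z : Type*} [MeasurableSpace Z] (μ : Measure Z)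
    [IsProbabilityMeasure μ] {m : ℕ} {g : Z → ℝ} (hg : Measurable g) {M : ℝ}
    (hM : ∀ᵐ z ∂μ, |g z| ≤ M) {κ ε : ℝ} (hκ : 0 ≤ κ)
    (hvar : 2 * κ * ∫ z, g z ^ 2 ∂μ ≤ ε * ∫ z, g z ∂μ) (z : Fin m → Z) :
    ENNReal.ofReal (Real.exp (κ / 2 * ∑ k, ((1 - ε) * ∫ x, g x ∂μ - g (z k)))) ≤
    ∫⁻ z' : Fin m → Z, ENNReal.ofReal (Real.exp (κ / 2 * ∑ k,
      ((g (z' k) - κ * g (z' k) ^ 2) - (g (z k) - κ * g (z k) ^ 2)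
        - κ * (g (z' k) ^ 2 + g (z k) ^ 2)))) ∂(Measure.pi fun _ => μ) := by
  have hg1 : Integrable g μ := Integrable.of_bound hg.aestronglyMeasurable M hM
  have hg2 : Integrable (fun x => g x ^ 2) μ := by
    refine Integrable.of_bound (by fun_prop) (M ^ 2) ?_
    filter_upwards [hM] with x hx
    rw [Real.norm_eq_abs, abs_pow]
    exact pow_le_pow_left₀ (abs_nonneg _) hx 2
  -- the summand as a function of the ghost point
  set ψ : Fin m → Z → ℝ := fun k x => (g x - κ * g x ^ 2) - (g (z k) - κ * g (z k) ^ 2)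
        - κ * (g x ^ 2 + g (z k) ^ 2) with hψ
  have hψm : ∀ k, Measurable (ψ k) := fun k => by fun_prop
  have hψi : ∀ k, Integrable (ψ k) μ := fun k => by fun_prop
  have hψint : ∀ k, ∫ x, ψ k x ∂μ = ∫ x, g x ∂μ - 2 * κ * ∫ x, g x ^ 2 ∂μ - g (z k) := fun k => by
    have h1 : ψ k = fun x => g x - 2 * κ * g x ^ 2 - g (z k) := by
      funext x; simp only [hψ]; ring
    rw [h1, integral_sub (by fun_prop) (by fun_prop), integral_sub hg1 (by fun_prop),
      integral_const_mul]
    simp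
  set Ψ : (Fin m → Z) → ℝ := fun z' => κ / 2 * ∑ k, ψ k (z' k) with hΨ
  have hΨm : Measurable Ψ := by
    refine Measurable.const_mul (Finset.measurable_sum _ fun k _ => ?_) _
    exact (hψm k).comp (measurable_pi_apply k)
  have hsum : ∀ k, Integrable (fun z' : Fin m → Z => ψ k (z' k)) (Measure.pi fun _ => μ) :=
    fun k => integrable_comp_eval (hψi k)
  have hΨi : Integrable Ψ (Measure.pi fun _ => μ) :=
    (integrable_finsetSum _ fun k _ => hsum k).const_mul _
  have hΨint : ∫ z', Ψ z' ∂(Measure.pi fun _ => μ) =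
      κ / 2 * ∑ k, (∫ x, g x ∂μ - 2 * κ * ∫ x, g x ^ 2 ∂μ - g (z k)) := by
    rw [hΨ, integral_const_mul, integral_finsetSum _ fun k _ => hsum k]
    congr 1
    refine Finset.sum_congr rfl fun k _ => ?_
    rw [← hψint k]
    exact integral_comp_eval (μ := fun _ : Fin m => μ) (hψm k).aestronglyMeasurable
  have hae : ∀ᵐ z' ∂(Measure.pi fun _ : Fin m => μ), ∀ k, |g (z' k)| ≤ M :=
    ae_all_iff.2 fun k => (measurePreserving_eval (fun _ : Fin m => μ) k).quasiMeasurePreserving.ae hM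
  have hexp : Integrable (Real.exp ∘ Ψ) (Measure.pi fun _ => μ) := by
    refine Integrable.of_bound (Real.measurable_exp.comp hΨm).aestronglyMeasurable
      (Real.exp (κ / 2 * ∑ k, (M - (g (z k) - κ * g (z k) ^ 2)))) ?_
    filter_upwards [hae] with z' hz'
    rw [Real.norm_eq_abs, Function.comp_apply, Real.abs_exp, Real.exp_le_exp]
    refine mul_le_mul_of_nonneg_left (Finset.sum_le_sum fun k _ => ?_) (by positivity)
    have h1 := (le_abs_self _).trans (hz' k)
    have h2 : 0 ≤ κ * g (z' k) ^ 2 := by positivity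
    have h3 : 0 ≤ κ * g (z k) ^ 2 := by positivity
    simp only [hψ]
    linarith
  have hjensen : Real.exp (∫ z', Ψ z' ∂(Measure.pi fun _ => μ)) ≤
      ∫ z', Real.exp (Ψ z') ∂(Measure.pi fun _ => μ) :=
    convexOn_exp.map_integral_le Real.continuous_exp.continuousOn isClosed_univ
      (Eventually.of_forall fun _ => Set.mem_univ _) hΨi hexp
  calc _ ≤ ENNReal.ofReal (∫ z', Real.exp (Ψ z') ∂(Measure.pi fun _ => μ)) := by
        refine ENNReal.ofReal_le_ofReal (le_trans (Real.exp_le_exp.2 ?_) hjensen)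
        rw [hΨint]
        refine mul_le_mul_of_nonneg_left (Finset.sum_le_sum fun k _ => ?_) (by positivity)
        linarith
    _ = _ := ofReal_integral_eq_lintegral_ofReal hexp
        (Eventually.of_forall fun _ => (Real.exp_pos _).le)

/-- Exchanging the two coordinates of a pair when the sign is negative. -/
def signSwap {Z : Type*} (b : Bool) (p : Z × Z) : Z × Z := if b then p else p.swap

theorem measurePreserving_signSwap {Z : Type*} [MeasurableSpace Z] (μ : Measure Z) [SFinite μ]
    (b : Bool) : MeasurePreserving (signSwap b) (μ.prod μ) (μ.prod μ) := by
  cases b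
  · exact Measure.measurePreserving_swap
  · exact MeasurePreserving.id _

theorem measurable_iSup_offsetExp {Z ι : Type*} [MeasurableSpace Z] [Countable ι] {m : ℕ}
    {g : ι → Z → ℝ} (hg : ∀ i, Measurable (g i)) (κ : ℝ) (σ : Fin m → Bool) :
    Measurable fun z : Fin m → Z =>
      ⨆ i, ENNReal.ofReal (offsetExp κ (fun k => g i (z k)) σ) := by
  refine Measurable.iSup fun i => ?_
  have := hg i
  unfold offsetExp
  fun_prop

/-- Symmetrization of the offset process. The exponential moment of the one-sided deviation
`(1 - ε) ∫ g - g(zₖ)`, uniformly over a countable family, is at most the sign average of the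
supremum of the offset weights on one sample. After swapping each pair of sample and ghost sample
point according to a sign, the two samples are decoupled by the inequality of the means. -/
theorem lintegral_iSup_exp_le_sum_offsetExp {Z ι : Type*} [MeasurableSpace Z] [Countable ι]
    (μ : Measure Z) [IsProbabilityMeasure μ] {m : ℕ} {g : ι → Z → ℝ} (hg : ∀ i, Measurable (g i))
    {M : ℝ} (hM : ∀ i, ∀ᵐ z ∂μ, |g i z| ≤ M) {κ ε : ℝ} (hκ : 0 ≤ κ)
    (hvar : ∀ i, 2 * κ * ∫ z, g i z ^ 2 ∂μ ≤ ε * ∫ z, g i z ∂μ) :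
    2 ^ m * ∫⁻ z : Fin m → Z, ⨆ i, ENNReal.ofReal
        (Real.exp (κ / 2 * ∑ k, ((1 - ε) * ∫ x, g i x ∂μ - g i (z k)))) ∂(Measure.pi fun _ => μ) ≤
      ∫⁻ z : Fin m → Z, ∑ σ, ⨆ i, ENNReal.ofReal (offsetExp κ (fun k => g i (z k)) σ)
        ∂(Measure.pi fun _ => μ) := by
  set P : Measure (Fin m → Z) := Measure.pi fun _ => μ with hP
  set Q : Measure (Fin m → Z × Z) := Measure.pi fun _ => μ.prod μ with hQ
  -- the symmetrized functional of a sample of pairs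
  set H : (Fin m → Z × Z) → ℝ≥0∞ := fun w => ⨆ i, ENNReal.ofReal (Real.exp (κ / 2 * ∑ k,
      ((g i (w k).2 - κ * g i (w k).2 ^ 2) - (g i (w k).1 - κ * g i (w k).1 ^ 2)
        - κ * (g i (w k).2 ^ 2 + g i (w k).1 ^ 2)))) with hH
  set A : (Fin m → Bool) → (Fin m → Z) → ℝ≥0∞ := fun σ z =>
    ⨆ i, ENNReal.ofReal (offsetExp κ (fun k => g i (z k)) σ) with hA
  have hAm : ∀ σ, Measurable (A σ) := fun σ => measurable_iSup_offsetExp hg κ σ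
  have hHm : Measurable H := by
    refine Measurable.iSup fun i => ?_
    have := hg i
    fun_prop
  have hpair : MeasurePreserving (MeasurableEquiv.arrowProdEquivProdArrow Z Z (Fin m)) Q
      (P.prod P) :=
    measurePreserving_arrowProdEquivProdArrow Z Z (Fin m) (fun _ => μ) (fun _ => μ)
  have hfst : MeasurePreserving (fun (w : Fin m → Z × Z) k => (w k).1) Q P :=
    measurePreserving_pi _ _ fun _ => measurePreserving_fst
  have hsnd : MeasurePreserving (fun (w : Fin m → Z × Z) k => (w k).2) Q P :=
    measurePreserving_pi _ _ fun _ => measurePreserving_snd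
  have hHp : Measurable fun p : (Fin m → Z) × (Fin m → Z) => H fun k => (p.1 k, p.2 k) :=
    hHm.comp (by fun_prop)
  -- a ghost sample is introduced
  have hghost : ∫⁻ z : Fin m → Z, ⨆ i, ENNReal.ofReal
      (Real.exp (κ / 2 * ∑ k, ((1 - ε) * ∫ x, g i x ∂μ - g i (z k)))) ∂P ≤ ∫⁻ w, H w ∂Q := by
    calc _ ≤ ∫⁻ z, ∫⁻ z', H (fun k => (z k, z' k)) ∂P ∂P := by
          refine lintegral_mono fun z => iSup_le fun i => ?_
          refine (exp_sum_le_lintegral_ghost μ (hg i) (hM i) hκ (hvar i) z).trans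
            (lintegral_mono fun z' => ?_)
          exact le_iSup (fun i => ENNReal.ofReal (Real.exp (κ / 2 * ∑ k,
            ((g i (z' k) - κ * g i (z' k) ^ 2) - (g i (z k) - κ * g i (z k) ^ 2)
              - κ * (g i (z' k) ^ 2 + g i (z k) ^ 2))))) i
      _ = ∫⁻ p, H (fun k => (p.1 k, p.2 k)) ∂(P.prod P) := by
          rw [lintegral_prod _ hHp.aemeasurable]
      _ = ∫⁻ w, H w ∂Q := by
          rw [← hpair.lintegral_comp hHp]
          rfl
  -- the functional is unchanged in law under swapping pairs, and then decouples
  have hswap : ∀ σ : Fin m → Bool, ∫⁻ w, H w ∂Q ≤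
      2⁻¹ * (∫⁻ z, A σ z ∂P + ∫⁻ z, A (fun k => !σ k) z ∂P) := fun σ => by
    have hmp : MeasurePreserving (fun (w : Fin m → Z × Z) k => signSwap (σ k) (w k)) Q Q :=
      measurePreserving_pi _ _ fun k => measurePreserving_signSwap μ (σ k)
    have hA2 : Measurable fun w : Fin m → Z × Z => A σ fun k => (w k).2 :=
      (hAm σ).comp hsnd.measurable
    have hA1 : Measurable fun w : Fin m → Z × Z => A (fun k => !σ k) fun k => (w k).1 :=
      (hAm _).comp hfst.measurable
    have hA12 : Measurable fun w : Fin m → Z × Z =>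
        (A σ fun k => (w k).2) + A (fun k => !σ k) fun k => (w k).1 := hA2.add hA1
    rw [← hmp.lintegral_comp hHm, ← hsnd.lintegral_comp (hAm _), ← hfst.lintegral_comp (hAm _),
      ← lintegral_add_left hA2, ← lintegral_const_mul _ hA12]
    refine lintegral_mono fun w => iSup_le fun i => ?_
    set x := offsetExp κ (fun k => g i (w k).2) σ
    set y := offsetExp κ (fun k => g i (w k).1) fun k => !σ k
    have hxy : Real.exp (κ / 2 * ∑ k,
        ((g i (signSwap (σ k) (w k)).2 - κ * g i (signSwap (σ k) (w k)).2 ^ 2)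
          - (g i (signSwap (σ k) (w k)).1 - κ * g i (signSwap (σ k) (w k)).1 ^ 2)
          - κ * (g i (signSwap (σ k) (w k)).2 ^ 2 + g i (signSwap (σ k) (w k)).1 ^ 2))) ≤
        2⁻¹ * (x + y) := by
      set a := κ / 2 * ∑ k, (boolSign (σ k) * (g i (w k).2 - κ * g i (w k).2 ^ 2)
        - κ * g i (w k).2 ^ 2) with ha
      set b := κ / 2 * ∑ k, (boolSign (!σ k) * (g i (w k).1 - κ * g i (w k).1 ^ 2)
        - κ * g i (w k).1 ^ 2) with hb
      have hx : x = Real.exp a ^ 2 := by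
        rw [sq, ← Real.exp_add, ha]; simp only [x, offsetExp]; congr 1; ring
      have hy : y = Real.exp b ^ 2 := by
        rw [sq, ← Real.exp_add, hb]; simp only [y, offsetExp]; congr 1; ring
      have hab : κ / 2 * ∑ k,
        ((g i (signSwap (σ k) (w k)).2 - κ * g i (signSwap (σ k) (w k)).2 ^ 2)
          - (g i (signSwap (σ k) (w k)).1 - κ * g i (signSwap (σ k) (w k)).1 ^ 2)
          - κ * (g i (signSwap (σ k) (w k)).2 ^ 2 + g i (signSwap (σ k) (w k)).1 ^ 2)) =
          a + b := by
        rw [ha, hb, ← mul_add, ← Finset.sum_add_distrib]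
        congr 1
        refine Finset.sum_congr rfl fun k _ => ?_
        cases σ k <;> simp [signSwap, boolSign] <;> ring
      rw [hab, Real.exp_add, hx, hy]
      nlinarith [sq_nonneg (Real.exp a - Real.exp b)]
    have hx0 : 0 ≤ x := (Real.exp_pos _).le
    have hy0 : 0 ≤ y := (Real.exp_pos _).le
    calc _ ≤ ENNReal.ofReal (2⁻¹ * (x + y)) := ENNReal.ofReal_le_ofReal hxy
      _ = 2⁻¹ * (ENNReal.ofReal x + ENNReal.ofReal y) := by
          rw [ENNReal.ofReal_mul (by norm_num), ENNReal.ofReal_add hx0 hy0,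
            ENNReal.ofReal_inv_of_pos two_pos, ENNReal.ofReal_ofNat]
      _ ≤ _ := by
          gcongr
          · exact le_iSup (fun i => ENNReal.ofReal (offsetExp κ (fun k => g i (w k).2) σ)) i
          · exact le_iSup (fun i => ENNReal.ofReal
              (offsetExp κ (fun k => g i (w k).1) fun k => !σ k)) i
  have hneg : ∑ σ : Fin m → Bool, ∫⁻ z, A (fun k => !σ k) z ∂P = ∑ σ, ∫⁻ z, A σ z ∂P :=
    Equiv.sum_comp (Equiv.arrowCongr (Equiv.refl (Fin m)) Equiv.boolNot)
      fun σ => ∫⁻ z, A σ z ∂P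
  calc _ ≤ 2 ^ m * ∫⁻ w, H w ∂Q := by gcongr
    _ = ∑ _σ : Fin m → Bool, ∫⁻ w, H w ∂Q := by simp
    _ ≤ ∑ σ, 2⁻¹ * (∫⁻ z, A σ z ∂P + ∫⁻ z, A (fun k => !σ k) z ∂P) :=
        Finset.sum_le_sum fun σ _ => hswap σ
    _ = ∑ σ, ∫⁻ z, A σ z ∂P := by
        rw [← Finset.mul_sum, Finset.sum_add_distrib, hneg, ← two_mul, ← mul_assoc,
          ENNReal.inv_mul_cancel (by norm_num) (by norm_num), one_mul]
    _ = _ := (lintegral_finsetSum _ fun σ _ => hAm σ).symm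

/-! ### The excess loss over the regression function -/

theorem measurable_logSeq {c : ℝ} {d n : ℕ} : Measurable (logSeq (c := c) (d := d) (n := n)) := by
  have h : Measurable (logZero c (d := d)) := by
    unfold logZero Real.artanh
    fun_prop
  unfold logSeq
  refine (WithLp.measurable_toLp 2 _).comp (measurable_pi_lambda _ fun p => ?_)
  exact (measurable_pi_apply p.1).comp ((WithLp.measurable_ofLp 2 _).comp
    (h.comp (measurable_pi_apply p.2)))

/-- The pointwise excess loss
`‖f(x) - log_0^c(y)‖² - ‖f_ρ(x) - log_0^c(y)‖²`, whose mean is the excess risk. -/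
noncomputable def excessLoss {c : ℝ} {d n : ℕ}
    (ρ : ProbabilityMeasure (TokenSeq c d n × TokenSeq c d n)) (f : TokenSeq c d n → Mat d n)
    (z : TokenSeq c d n × TokenSeq c d n) : ℝ :=
  ‖f z.1 - logSeq c z.2‖ ^ 2 - ‖regressionFun ρ z.1 - logSeq c z.2‖ ^ 2

section

variable {c : ℝ} {d n : ℕ} {ρ : ProbabilityMeasure (TokenSeq c d n × TokenSeq c d n)}

theorem measurable_regressionFun : Measurable (regressionFun ρ) := by
  have h : StronglyMeasurable fun p : TokenSeq c d n × TokenSeq c d n => logSeq c p.2 :=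
    (measurable_logSeq.comp measurable_snd).stronglyMeasurable
  exact h.integral_kernel_prod_right'.measurable

theorem measurable_excessLoss {f : TokenSeq c d n → Mat d n} (hf : Measurable f) :
    Measurable (excessLoss ρ f) := by
  have h1 := measurable_logSeq (c := c) (d := d) (n := n)
  have h2 := measurable_regressionFun (ρ := ρ)
  unfold excessLoss
  fun_prop

/-- Conditional means of a bounded target are bounded. -/
theorem ae_norm_regressionFun_le {B : ℝ}
    (hB : ∀ᵐ z ∂(ρ : Measure (TokenSeq c d n × TokenSeq c d n)), ‖logSeq c z.2‖ ≤ B) :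
    ∀ᵐ z ∂(ρ : Measure (TokenSeq c d n × TokenSeq c d n)), ‖regressionFun ρ z.1‖ ≤ B := by
  set μ := (ρ : Measure (TokenSeq c d n × TokenSeq c d n)) with hμ
  have h1 : ∀ᵐ x ∂μ.fst, ∀ᵐ y ∂μ.condKernel x, ‖logSeq c y‖ ≤ B := by
    rw [← μ.disintegrate μ.condKernel] at hB
    exact Measure.ae_ae_of_ae_compProd hB
  have h2 : ∀ᵐ x ∂μ.fst, ‖regressionFun ρ x‖ ≤ B := by
    filter_upwards [h1] with x hx
    simpa [regressionFun] using norm_integral_le_of_norm_le_const hx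
  exact ae_of_ae_map measurable_fst.aemeasurable h2

theorem abs_norm_sub_sq_sub_le {E : Type*} [NormedAddCommGroup E] {B : ℝ} {u v w : E}
    (hu : ‖u‖ ≤ B) (hv : ‖v‖ ≤ B) (hw : ‖w‖ ≤ B) :
    |‖u - w‖ ^ 2 - ‖v - w‖ ^ 2| ≤ 4 * B * ‖u - v‖ := by
  have h1 : |‖u - w‖ - ‖v - w‖| ≤ ‖u - v‖ := by
    simpa using abs_norm_sub_norm_le (u - w) (v - w)
  have h2 : ‖u - w‖ ≤ 2 * B := (norm_sub_le _ _).trans (by linarith)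
  have h3 : ‖v - w‖ ≤ 2 * B := (norm_sub_le _ _).trans (by linarith)
  rw [sq_sub_sq, abs_mul, abs_of_nonneg (by positivity)]
  exact mul_le_mul (by linarith) h1 (abs_nonneg _) (by linarith [norm_nonneg (u - w)])

theorem abs_norm_sub_sq_sub_le_sq {E : Type*} [NormedAddCommGroup E] {B : ℝ} {u v w : E}
    (hu : ‖u‖ ≤ B) (hv : ‖v‖ ≤ B) (hw : ‖w‖ ≤ B) :
    |‖u - w‖ ^ 2 - ‖v - w‖ ^ 2| ≤ 4 * B ^ 2 := by
  have h2 : ‖u - w‖ ≤ 2 * B := (norm_sub_le _ _).trans (by linarith)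
  have h3 : ‖v - w‖ ≤ 2 * B := (norm_sub_le _ _).trans (by linarith)
  have h4 := norm_nonneg (u - w)
  have h5 := norm_nonneg (v - w)
  rw [abs_le]
  constructor <;> nlinarith

variable {B : ℝ} {X : Set (TokenSeq c d n)} {T : Set (TokenSeq c d n → Mat d n)}

/-- Almost every draw has its input in `X`, and its target and regression value bounded
by `B`. -/
theorem BoundedRegression.ae_good (h : BoundedRegression B X ρ T) :
    ∀ᵐ z ∂(ρ : Measure (TokenSeq c d n × TokenSeq c d n)),
      z.1 ∈ X ∧ ‖logSeq c z.2‖ ≤ B ∧ ‖regressionFun ρ z.1‖ ≤ B := by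
  filter_upwards [h.input_mem, h.target_le, ae_norm_regressionFun_le h.target_le] with z h1 h2 h3
  exact ⟨h1, h2, h3⟩

theorem BoundedRegression.abs_excessLoss_le (h : BoundedRegression B X ρ T)
    {f : TokenSeq c d n → Mat d n} (hf : f ∈ T) {z : TokenSeq c d n × TokenSeq c d n}
    (hz : z.1 ∈ X ∧ ‖logSeq c z.2‖ ≤ B ∧ ‖regressionFun ρ z.1‖ ≤ B) :
    |excessLoss ρ f z| ≤ 4 * B ^ 2 :=
  abs_norm_sub_sq_sub_le_sq (h.bounded f hf _ hz.1) hz.2.2 hz.2.1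

theorem BoundedRegression.integrable_excessLoss (h : BoundedRegression B X ρ T)
    {f : TokenSeq c d n → Mat d n} (hf : f ∈ T) :
    Integrable (excessLoss ρ f) (ρ : Measure (TokenSeq c d n × TokenSeq c d n)) := by
  refine Integrable.of_bound (measurable_excessLoss (h.measurable f hf)).aestronglyMeasurable
    (4 * B ^ 2) ?_
  filter_upwards [h.ae_good] with z hz
  exact h.abs_excessLoss_le hf hz

theorem BoundedRegression.excessRisk_eq_integral (h : BoundedRegression B X ρ T)
    {f : TokenSeq c d n → Mat d n} (hf : f ∈ T) :
    excessRisk ρ f =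
      ∫ z, excessLoss ρ f z ∂(ρ : Measure (TokenSeq c d n × TokenSeq c d n)) := by
  have hL := measurable_logSeq (c := c) (d := d) (n := n)
  have hr := measurable_regressionFun (ρ := ρ)
  have key : ∀ g : TokenSeq c d n → Mat d n, Measurable g →
      (∀ᵐ z ∂(ρ : Measure (TokenSeq c d n × TokenSeq c d n)), ‖g z.1‖ ≤ B) →
      Integrable (fun z => ‖g z.1 - logSeq c z.2‖ ^ 2)
        (ρ : Measure (TokenSeq c d n × TokenSeq c d n)) := fun g hg hgB => by
    refine Integrable.of_bound (Measurable.aestronglyMeasurable (by fun_prop)) ((2 * B) ^ 2) ?_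
    filter_upwards [hgB, h.target_le] with z h1 h2
    rw [Real.norm_eq_abs, abs_of_nonneg (by positivity)]
    exact pow_le_pow_left₀ (norm_nonneg _) ((norm_sub_le _ _).trans (by linarith)) 2
  rw [excessRisk, risk, risk, ← integral_sub]
  · rfl
  · exact key f (h.measurable f hf) (h.input_mem.mono fun z hz => h.bounded f hf _ hz)
  · exact key _ hr (ae_norm_regressionFun_le h.target_le)

/-- The excess risk is the squared `L²`-distance to the regression function, since the residual
`f_ρ(x) - log_0^c(y)` has conditional mean zero given `x`. -/
theorem BoundedRegression.integral_excessLoss_eq (h : BoundedRegression B X ρ T)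
    {f : TokenSeq c d n → Mat d n} (hf : f ∈ T) :
    ∫ z, excessLoss ρ f z ∂(ρ : Measure (TokenSeq c d n × TokenSeq c d n)) =
      ∫ z, ‖f z.1 - regressionFun ρ z.1‖ ^ 2
        ∂(ρ : Measure (TokenSeq c d n × TokenSeq c d n)) := by
  set μ := (ρ : Measure (TokenSeq c d n × TokenSeq c d n)) with hμ
  have hL := measurable_logSeq (c := c) (d := d) (n := n)
  have hr := measurable_regressionFun (ρ := ρ)
  have hfm := h.measurable f hf
  have hLi : Integrable (fun z : TokenSeq c d n × TokenSeq c d n => logSeq c z.2) μ :=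
    Integrable.of_bound (hL.comp measurable_snd).aestronglyMeasurable B h.target_le
  have hdiff : ∀ᵐ z ∂μ, ‖f z.1 - regressionFun ρ z.1‖ ≤ 2 * B := by
    filter_upwards [h.ae_good] with z hz
    refine (norm_sub_le _ _).trans ?_
    linarith [h.bounded f hf _ hz.1, hz.2.2]
  have hi1 : Integrable (fun z => ‖f z.1 - regressionFun ρ z.1‖ ^ 2) μ := by
    refine Integrable.of_bound (Measurable.aestronglyMeasurable (by fun_prop)) ((2 * B) ^ 2) ?_
    filter_upwards [hdiff] with z hz
    rw [Real.norm_eq_abs, abs_of_nonneg (by positivity)]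
    exact pow_le_pow_left₀ (norm_nonneg _) hz 2
  have hi2 : Integrable (fun z => inner ℝ (f z.1 - regressionFun ρ z.1)
      (regressionFun ρ z.1 - logSeq c z.2)) μ := by
    refine Integrable.of_bound (Measurable.aestronglyMeasurable (by fun_prop))
      ((2 * B) * (2 * B)) ?_
    filter_upwards [hdiff, h.ae_good] with z h1 h2
    refine (norm_inner_le_norm _ _).trans (mul_le_mul h1 ((norm_sub_le _ _).trans ?_)
      (norm_nonneg _) ((norm_nonneg _).trans h1))
    linarith [h2.2.1, h2.2.2]
  have horth : ∫ z, inner ℝ (f z.1 - regressionFun ρ z.1)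
      (regressionFun ρ z.1 - logSeq c z.2) ∂μ = 0 := by
    rw [← Measure.integral_condKernel hi2]
    refine integral_eq_zero_of_ae ?_
    filter_upwards [hLi.condKernel_ae] with x hx
    have hsub : Integrable (fun y => regressionFun ρ x - logSeq c y) (μ.condKernel x) :=
      (integrable_const _).sub hx
    rw [integral_inner hsub, integral_sub (integrable_const _) hx]
    simp [regressionFun, hμ]
  have hdecomp : ∀ z, excessLoss ρ f z = ‖f z.1 - regressionFun ρ z.1‖ ^ 2 +
      2 * inner ℝ (f z.1 - regressionFun ρ z.1) (regressionFun ρ z.1 - logSeq c z.2) :=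
    fun z => by
    rw [excessLoss, ← sub_add_sub_cancel (f z.1) (regressionFun ρ z.1) (logSeq c z.2),
      norm_add_sq_real]
    ring
  simp_rw [hdecomp]
  rw [integral_add hi1 (hi2.const_mul 2), integral_const_mul, horth]
  simp

/-- The variance condition: the second moment of the excess loss is controlled by its mean. -/
theorem BoundedRegression.integral_excessLoss_sq_le (h : BoundedRegression B X ρ T)
    {f : TokenSeq c d n → Mat d n} (hf : f ∈ T) :
    ∫ z, excessLoss ρ f z ^ 2 ∂(ρ : Measure (TokenSeq c d n × TokenSeq c d n)) ≤
      16 * B ^ 2 * ∫ z, excessLoss ρ f z ∂(ρ : Measure (TokenSeq c d n × TokenSeq c d n)) := by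
  have hr := measurable_regressionFun (ρ := ρ)
  have hfm := h.measurable f hf
  rw [h.integral_excessLoss_eq hf, ← integral_const_mul]
  refine integral_mono_of_nonneg (Eventually.of_forall fun z => sq_nonneg _) ?_ ?_
  · refine Integrable.const_mul ?_ _
    refine Integrable.of_bound (Measurable.aestronglyMeasurable (by fun_prop)) ((2 * B) ^ 2) ?_
    filter_upwards [h.ae_good] with z hz
    rw [Real.norm_eq_abs, abs_of_nonneg (by positivity)]
    refine pow_le_pow_left₀ (norm_nonneg _) ((norm_sub_le _ _).trans ?_) 2
    linarith [h.bounded f hf _ hz.1, hz.2.2]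
  · filter_upwards [h.ae_good] with z hz
    have h1 := abs_norm_sub_sq_sub_le (h.bounded f hf _ hz.1) hz.2.2 hz.2.1
    calc excessLoss ρ f z ^ 2 = |excessLoss ρ f z| ^ 2 := (sq_abs _).symm
      _ ≤ (4 * B * ‖f z.1 - regressionFun ρ z.1‖) ^ 2 := pow_le_pow_left₀ (abs_nonneg _) h1 2
      _ = _ := by ring

theorem BoundedRegression.excessRisk_le (h : BoundedRegression B X ρ T)
    {f : TokenSeq c d n → Mat d n} (hf : f ∈ T) : excessRisk ρ f ≤ 4 * B ^ 2 := by
  rw [h.excessRisk_eq_integral hf]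
  have := norm_integral_le_of_norm_le_const (f := excessLoss ρ f)
    (h.ae_good.mono fun z hz => h.abs_excessLoss_le hf hz)
  simp only [probReal_univ, mul_one] at this
  exact (le_abs_self _).trans this

theorem empExcessRisk_eq_sum {m : ℕ} (z : Fin m → TokenSeq c d n × TokenSeq c d n)
    (f : TokenSeq c d n → Mat d n) :
    empExcessRisk ρ z f = (1 / (m : ℝ)) * ∑ k, excessLoss ρ f (z k) := by
  simp only [empExcessRisk, empRisk, excessLoss, ← mul_sub, ← Finset.sum_sub_distrib]

/-- The excess losses of two functions differ on a sample by at most `4 B` times their distance in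
`L¹` of the empirical measure. -/
theorem BoundedRegression.sum_abs_excessLoss_sub_le (h : BoundedRegression B X ρ T) (hB : 0 ≤ B)
    {f g : TokenSeq c d n → Mat d n} (hf : f ∈ T) (hg : g ∈ T) {m : ℕ} (hm : 0 < m)
    {z : Fin m → TokenSeq c d n × TokenSeq c d n}
    (hz : ∀ k, (z k).1 ∈ X ∧ ‖logSeq c (z k).2‖ ≤ B ∧ ‖regressionFun ρ (z k).1‖ ≤ B) :
    ∑ k, |excessLoss ρ f (z k) - excessLoss ρ g (z k)| ≤
      4 * B * m * empL1Dist (fun k => (z k).1) f g := by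
  have hnorm : ∀ v : Mat d n, ‖v‖ ≤ ∑ p, |v p| := fun v => by
    rw [EuclideanSpace.norm_eq, Real.sqrt_le_left (Finset.sum_nonneg fun _ _ => abs_nonneg _)]
    exact Finset.sum_sq_le_sq_sum_of_nonneg fun _ _ => abs_nonneg _
  calc _ ≤ ∑ k, 4 * B * ∑ p, |f (z k).1 p - g (z k).1 p| := by
        refine Finset.sum_le_sum fun k _ => ?_
        rw [excessLoss, excessLoss, sub_sub_sub_cancel_right]
        refine (abs_norm_sub_sq_sub_le (h.bounded f hf _ (hz k).1) (h.bounded g hg _ (hz k).1)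
          (hz k).2.1).trans ?_
        exact mul_le_mul_of_nonneg_left (hnorm _) (by positivity)
    _ = _ := by
        have : (m : ℝ) ≠ 0 := by positivity
        rw [empL1Dist, ← Finset.mul_sum]
        field_simp

end

/-! ### Covers and separability -/

section

variable {c : ℝ} {d n : ℕ} {ρ : ProbabilityMeasure (TokenSeq c d n × TokenSeq c d n)}
  {B : ℝ} {X : Set (TokenSeq c d n)} {T : Set (TokenSeq c d n → Mat d n)}

theorem empL1Dist_le_add {m : ℕ} (x : Fin m → TokenSeq c d n)
    (f g k : TokenSeq c d n → Mat d n) :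
    empL1Dist x f g ≤ empL1Dist x f k + empL1Dist x g k := by
  rw [empL1Dist, empL1Dist, empL1Dist, ← mul_add, ← Finset.sum_add_distrib]
  refine mul_le_mul_of_nonneg_left (Finset.sum_le_sum fun i _ => ?_) (by positivity)
  rw [← Finset.sum_add_distrib]
  refine Finset.sum_le_sum fun p _ => ?_
  rw [abs_sub_comm (g (x i) p)]
  exact abs_sub_le _ _ _

/-- A minimal cover of `T` by balls of radius `r` yields a net of a subset `S` of `T` that lies in
`S` itself, has no more elements, and width `2 r`. -/
theorem exists_finset_card_le_coveringNumber {m : ℕ} {r : ℝ} {S : Set (TokenSeq c d n → Mat d n)}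
    (hST : S ⊆ T) (x : Fin m → TokenSeq c d n) (hN : coveringNumber r T x ≠ ⊤) :
    ∃ C : Finset S, (C.card : ℕ∞) ≤ coveringNumber r T x ∧
      ∀ s : S, ∃ j ∈ C, empL1Dist x s.1 j.1 ≤ 2 * r := by
  classical
  obtain ⟨G, hG, hcard⟩ : ∃ G : Finset (TokenSeq c d n → Mat d n),
      (∀ f ∈ T, ∃ g ∈ G, empL1Dist x f g < r) ∧ (G.card : ℕ∞) = coveringNumber r T x := by
    obtain ⟨G, hG⟩ := ENat.exists_eq_iInf fun G : Finset (TokenSeq c d n → Mat d n) =>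
      ⨅ (_ : ∀ f ∈ T, ∃ g ∈ G, empL1Dist x f g < r), (G.card : ℕ∞)
    by_cases hcov : ∀ f ∈ T, ∃ g ∈ G, empL1Dist x f g < r
    · refine ⟨G, hcov, ?_⟩
      rw [coveringNumber, ← hG, iInf_pos hcov]
    · refine absurd ?_ hN
      rw [coveringNumber, ← hG, iInf_neg hcov]
  -- a ball that meets `S` is recentred at one of its points in `S`
  let pick : (TokenSeq c d n → Mat d n) → Option S := fun g =>
    if h : ∃ s : S, empL1Dist x s.1 g < r then some h.choose else none
  refine ⟨G.biUnion fun g => (pick g).toFinset, ?_, fun s => ?_⟩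
  · rw [← hcard, Nat.cast_le]
    refine Finset.card_biUnion_le.trans ?_
    calc _ ≤ ∑ _g ∈ G, 1 := Finset.sum_le_sum fun g _ => by
          rw [Option.card_toFinset]; cases pick g <;> simp
      _ = _ := by simp
  · obtain ⟨g, hg, hsg⟩ := hG s.1 (hST s.2)
    have hex : ∃ s : S, empL1Dist x s.1 g < r := ⟨s, hsg⟩
    refine ⟨hex.choose, Finset.mem_biUnion.2 ⟨g, hg, ?_⟩, ?_⟩
    · rw [Option.mem_toFinset]; simp only [pick, dif_pos hex, Option.mem_def]
    · linarith [empL1Dist_le_add x s.1 hex.choose.1 g, hex.choose_spec]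

/-- Along a sequence of the class that converges pointwise on `X`, the deviation
`(1 - ε) Δ_ρ - Δ_D` converges. -/
theorem BoundedRegression.tendsto_deviation (h : BoundedRegression B X ρ T)
    {f : TokenSeq c d n → Mat d n} (hf : f ∈ T) {u : ℕ → TokenSeq c d n → Mat d n}
    (hu : ∀ k, u k ∈ T) (hlim : ∀ x ∈ X, Tendsto (fun k => u k x) atTop (𝓝 (f x))) {m : ℕ}
    {z : Fin m → TokenSeq c d n × TokenSeq c d n} (hz : ∀ i, (z i).1 ∈ X) (ε : ℝ) :
    Tendsto (fun k => (1 - ε) * excessRisk ρ (u k) - empExcessRisk ρ z (u k)) atTop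
      (𝓝 ((1 - ε) * excessRisk ρ f - empExcessRisk ρ z f)) := by
  have hpt : ∀ w : TokenSeq c d n × TokenSeq c d n, w.1 ∈ X →
      Tendsto (fun k => excessLoss ρ (u k) w) atTop (𝓝 (excessLoss ρ f w)) := fun w hw =>
    (((hlim _ hw).sub_const _).norm.pow 2).sub_const _
  have h1 : Tendsto (fun k => excessRisk ρ (u k)) atTop (𝓝 (excessRisk ρ f)) := by
    simp_rw [h.excessRisk_eq_integral hf, fun k => h.excessRisk_eq_integral (hu k)]
    refine tendsto_integral_of_dominated_convergence (fun _ => 4 * B ^ 2)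
      (fun k => (measurable_excessLoss (h.measurable _ (hu k))).aestronglyMeasurable)
      (integrable_const _) (fun k => ?_) ?_
    · filter_upwards [h.ae_good] with w hw
      exact h.abs_excessLoss_le (hu k) hw
    · filter_upwards [h.input_mem] with w hw
      exact hpt w hw
  have h2 : Tendsto (fun k => empExcessRisk ρ z (u k)) atTop (𝓝 (empExcessRisk ρ z f)) := by
    simp_rw [empExcessRisk_eq_sum]
    exact (tendsto_finsetSum _ fun i _ => hpt _ (hz i)).const_mul _
  exact (h1.const_mul _).sub h2

/-! ### The exponential tail bound -/

/-- On a sample whose points satisfy the almost sure bounds, the offset weights of the excess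
losses are controlled by the covering number. A net of width `2 r` in `L¹` makes the excess losses
vary by at most `8 B m r` in total, which the weights turn into `9 B m r`. -/
theorem BoundedRegression.sum_iSup_offsetExp_excessLoss_le (h : BoundedRegression B X ρ T)
    (hB : 0 < B) {S : Set (TokenSeq c d n → Mat d n)} (hST : S ⊆ T) {m : ℕ} (hm : 0 < m)
    {r ε : ℝ} (hε : 0 ≤ ε) (hε2 : ε ≤ 1 / 2)
    {z : Fin m → TokenSeq c d n × TokenSeq c d n}
    (hz : ∀ k, (z k).1 ∈ X ∧ ‖logSeq c (z k).2‖ ≤ B ∧ ‖regressionFun ρ (z k).1‖ ≤ B) :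
    ∑ σ, ⨆ s : S, ENNReal.ofReal
        (offsetExp (ε / (64 * B ^ 2)) (fun k => excessLoss ρ s.1 (z k)) σ) ≤
      2 ^ m * (supCoveringNumber m r X T *
        ENNReal.ofReal (Real.exp (ε / (64 * B ^ 2) * (9 * B * m * r)))) := by
  set x : Fin m → TokenSeq c d n := fun k => (z k).1
  have hsup : (coveringNumber r T x).toENNReal ≤ supCoveringNumber m r X T :=
    le_iSup₂ (f := fun (x : Fin m → TokenSeq c d n) (_ : ∀ i, x i ∈ X) =>
      (coveringNumber r T x).toENNReal) x fun k => (hz k).1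
  have hexp : ENNReal.ofReal (Real.exp (ε / (64 * B ^ 2) * (9 * B * m * r))) ≠ 0 := by
    simp [Real.exp_pos]
  by_cases hN : coveringNumber r T x = ⊤
  · rw [hN, ENat.toENNReal_top, top_le_iff] at hsup
    rw [hsup, ENNReal.top_mul hexp, ENNReal.mul_top (by simp)]
    exact le_top
  · obtain ⟨C, hC, hnet⟩ := exists_finset_card_le_coveringNumber hST x hN
    have hκ : 0 ≤ ε / (64 * B ^ 2) := by positivity
    refine (sum_iSup_offsetExp_le (δ := 4 * B * m * (2 * r)) hκ
      (fun (s : S) k => excessLoss ρ s.1 (z k)) C (fun s k => ?_) fun s => ?_).trans ?_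
    · rw [abs_mul, abs_of_nonneg hκ]
      refine (mul_le_mul_of_nonneg_left (h.abs_excessLoss_le (hST s.2) (hz k)) hκ).trans ?_
      rw [div_mul_eq_mul_div, div_le_iff₀ (by positivity)]
      nlinarith [sq_nonneg B]
    · obtain ⟨j, hj, hsj⟩ := hnet s
      refine ⟨j, hj, (h.sum_abs_excessLoss_sub_le hB.le (hST s.2) (hST j.2) hm hz).trans ?_⟩
      exact mul_le_mul_of_nonneg_left hsj (by positivity)
    · have hC' : (C.card : ℝ≥0∞) ≤ supCoveringNumber m r X T :=
        le_trans (by exact_mod_cast ENat.toENNReal_le.2 hC) hsup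
      rw [show 9 / 8 * (4 * B * m * (2 * r)) = 9 * B * m * r by ring]
      gcongr

/-- The tail bound with its natural constants: Markov's inequality for the exponential moment of
the supremum over a countable dense subclass. -/
theorem BoundedRegression.sampleLaw_deviation_le (h : BoundedRegression B X ρ T) (hB : 0 < B)
    {m : ℕ} (hm : 0 < m) {α β ε : ℝ} (hβ : 0 < β) (hε : 0 < ε) (hε2 : ε ≤ 1 / 2) :
    sampleLaw ρ m {z | ∃ f ∈ T,
        ε * (α + β + excessRisk ρ f) ≤ excessRisk ρ f - empExcessRisk ρ z f} ≤
      supCoveringNumber m (β * ε / (20 * B)) X T *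
        ENNReal.ofReal (Real.exp (-(ε ^ 2 * α * m / (128 * B ^ 2)))) := by
  obtain ⟨S, hST, hS, hdense⟩ := h.separable
  have : Countable S := hS.to_subtype
  set μ := (ρ : Measure (TokenSeq c d n × TokenSeq c d n)) with hμ
  set N := supCoveringNumber m (β * ε / (20 * B)) X T
  set κ := ε / (64 * B ^ 2) with hκdef
  have hκ : 0 < κ := by positivity
  have hmR : (0 : ℝ) < m := by exact_mod_cast hm
  -- of the slack `ε β`, passing to the dense subclass costs a tenth and the net the other nine
  set L := κ / 2 * (m * (ε * (α + β) - ε * β / 10)) with hL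
  set W : (Fin m → TokenSeq c d n × TokenSeq c d n) → ℝ≥0∞ := fun z => ⨆ s : S, ENNReal.ofReal
    (Real.exp (κ / 2 * ∑ k, ((1 - ε) * ∫ x, excessLoss ρ s.1 x ∂μ - excessLoss ρ s.1 (z k))))
    with hW
  have hgood : ∀ᵐ z ∂(sampleLaw ρ m), ∀ k, (z k).1 ∈ X ∧ ‖logSeq c (z k).2‖ ≤ B ∧
      ‖regressionFun ρ (z k).1‖ ≤ B :=
    ae_all_iff.2 fun k =>
      (measurePreserving_eval (fun _ : Fin m => μ) k).quasiMeasurePreserving.ae h.ae_good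
  have hWm : Measurable W := by
    refine Measurable.iSup fun s => ?_
    have := measurable_excessLoss (ρ := ρ) (h.measurable _ (hST s.2))
    fun_prop
  have hevent : sampleLaw ρ m {z | ∃ f ∈ T,
        ε * (α + β + excessRisk ρ f) ≤ excessRisk ρ f - empExcessRisk ρ z f} ≤
      sampleLaw ρ m {z | ENNReal.ofReal (Real.exp L) ≤ W z} := by
    refine measure_mono_ae ?_
    filter_upwards [hgood] with z hz
    rintro ⟨f, hf, hfz⟩
    obtain ⟨u, huS, hlim⟩ := hdense f hf
    have htend := h.tendsto_deviation hf (fun k => hST (huS k)) hlim (fun k => (hz k).1) ε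
    obtain ⟨k, hk⟩ := (htend.eventually_const_lt
      (u := ε * (α + β) - ε * β / 10) (by nlinarith [mul_pos hε hβ])).exists
    refine le_trans (ENNReal.ofReal_le_ofReal (Real.exp_le_exp.2 ?_))
      (le_iSup (fun s : S => ENNReal.ofReal (Real.exp (κ / 2 * ∑ k,
        ((1 - ε) * ∫ x, excessLoss ρ s.1 x ∂μ - excessLoss ρ s.1 (z k))))) ⟨u k, huS k⟩)
    refine mul_le_mul_of_nonneg_left ?_ (by positivity)
    rw [empExcessRisk_eq_sum, h.excessRisk_eq_integral (hST (huS k))] at hk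
    have h1 := mul_le_mul_of_nonneg_left hk.le hmR.le
    rw [mul_sub _ ((1 - ε) * _), ← mul_assoc (m : ℝ) (1 / (m : ℝ)),
      mul_one_div_cancel hmR.ne', one_mul] at h1
    rw [Finset.sum_sub_distrib, Finset.sum_const, Finset.card_univ, Fintype.card_fin,
      nsmul_eq_mul]
    exact h1
  have hmoment : ∫⁻ z, W z ∂(sampleLaw ρ m) ≤
      N * ENNReal.ofReal (Real.exp (κ * (9 * B * m * (β * ε / (20 * B))))) := by
    have hsym := lintegral_iSup_exp_le_sum_offsetExp μ (m := m)
      (g := fun (s : S) => excessLoss ρ s.1)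
      (fun s => measurable_excessLoss (h.measurable _ (hST s.2)))
      (fun s => h.ae_good.mono fun z hz => h.abs_excessLoss_le (hST s.2) hz) hκ.le
      (ε := ε) fun s => by
        have hnn : 0 ≤ ∫ z, excessLoss ρ s.1 z ∂μ := by
          rw [h.integral_excessLoss_eq (hST s.2)]
          exact integral_nonneg fun z => sq_nonneg _
        calc 2 * κ * ∫ z, excessLoss ρ s.1 z ^ 2 ∂μ
            ≤ 2 * κ * (16 * B ^ 2 * ∫ z, excessLoss ρ s.1 z ∂μ) :=
              mul_le_mul_of_nonneg_left (h.integral_excessLoss_sq_le (hST s.2)) (by positivity)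
          _ = ε / 2 * ∫ z, excessLoss ρ s.1 z ∂μ := by rw [hκdef]; field_simp; ring
          _ ≤ ε * ∫ z, excessLoss ρ s.1 z ∂μ :=
              mul_le_mul_of_nonneg_right (by linarith) hnn
    have hnet : ∫⁻ z, ∑ σ, ⨆ s : S, ENNReal.ofReal
        (offsetExp κ (fun k => excessLoss ρ s.1 (z k)) σ) ∂(sampleLaw ρ m) ≤
        2 ^ m * (N * ENNReal.ofReal (Real.exp (κ * (9 * B * m * (β * ε / (20 * B)))))) := by
      have : IsProbabilityMeasure (sampleLaw ρ m) := by unfold sampleLaw; infer_instance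
      refine (lintegral_mono_ae (hgood.mono fun z hz => h.sum_iSup_offsetExp_excessLoss_le
        (r := β * ε / (20 * B)) hB hST hm hε.le hε2 hz)).trans ?_
      rw [lintegral_const, measure_univ, mul_one]
    refine (ENNReal.mul_le_mul_iff_right (a := 2 ^ m) (by simp) (by simp)).1 ?_
    exact hsym.trans hnet
  have hLpos : 0 < Real.exp L := Real.exp_pos L
  calc _ ≤ sampleLaw ρ m {z | ENNReal.ofReal (Real.exp L) ≤ W z} := hevent
    _ ≤ (∫⁻ z, W z ∂(sampleLaw ρ m)) / ENNReal.ofReal (Real.exp L) :=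
        meas_ge_le_lintegral_div hWm.aemeasurable (by simpa using hLpos) ENNReal.ofReal_ne_top
    _ ≤ N * ENNReal.ofReal (Real.exp (κ * (9 * B * m * (β * ε / (20 * B))))) /
          ENNReal.ofReal (Real.exp L) := by gcongr
    _ = N * ENNReal.ofReal (Real.exp (-(ε ^ 2 * α * m / (128 * B ^ 2)))) := by
        rw [mul_div_assoc, ← ENNReal.ofReal_div_of_pos hLpos, ← Real.exp_sub]
        congr 3
        rw [hL, hκdef]
        field_simp
        ring

theorem BoundedRegression.sampleLaw_deviation_le_of_one_le (h : BoundedRegression B X ρ T)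
    (hB : 1 ≤ B) {m : ℕ} (hm : 1 ≤ m) {α β ε : ℝ} (hα : 0 < α) (hβ : 0 < β) (hε : 0 < ε)
    (hε2 : ε < 1 / 2) :
    sampleLaw ρ m {z | ∃ f ∈ T,
        ε * (α + β + excessRisk ρ f) ≤ excessRisk ρ f - empExcessRisk ρ z f} ≤
      14 * supCoveringNumber m (β * ε / (20 * B)) X T *
        ENNReal.ofReal (Real.exp
          (-(ε ^ 2 * (1 - ε) * α * m / (214 * (1 + ε) * B ^ 4)))) := by
  have hB0 : 0 < B := by linarith
  refine (h.sampleLaw_deviation_le hB0 hm hβ hε hε2.le).trans ?_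
  refine mul_le_mul' (le_mul_of_one_le_left zero_le (by norm_num))
    (ENNReal.ofReal_le_ofReal (Real.exp_le_exp.2 (neg_le_neg ?_)))
  have hB2 : 1 ≤ B ^ 2 := one_le_pow₀ hB
  have hden : 128 * B ^ 2 ≤ 214 * (1 + ε) * B ^ 4 := by nlinarith [mul_pos hε (pow_pos hB0 4)]
  refine div_le_div₀ (by positivity) ?_ (by positivity) hden
  have : 0 ≤ ε ^ 2 * α * m := by positivity
  nlinarith

/-! ### Rates -/

/-- The tail bound at `α = β = K` and `ε = t ^ (-θ)`. -/
theorem BoundedRegression.sampleLaw_rate_le (h : BoundedRegression B X ρ T) (hB : 1 ≤ B)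
    (hd : 1 ≤ d) {θ K : ℝ} (hθ : 0 < θ) (hK : 0 < K) {t : ℕ} (ht : 1 ≤ t)
    (htθ : (t : ℝ) ^ (-θ) < 1 / 2) :
    sampleLaw ρ t {z | ∃ f ∈ T,
        (2 * K + 4 * B ^ 2) * (t : ℝ) ^ (-θ) ≤ excessRisk ρ f - empExcessRisk ρ z f} ≤
      14 * supCoveringNumber t (K * (t : ℝ) ^ (-θ) / (20 * B)) X T *
        ENNReal.ofReal (Real.exp
          (-(K * (t : ℝ) ^ (1 - 2 * d * θ) / (214 * (3 * B ^ 4) ^ d)))) := by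
  have ht1 : (1 : ℝ) ≤ t := by exact_mod_cast ht
  have ht0 : (0 : ℝ) < t := by linarith
  have hdR : (1 : ℝ) ≤ d := by exact_mod_cast hd
  set ε := (t : ℝ) ^ (-θ) with hεdef
  have hε : 0 < ε := Real.rpow_pos_of_pos ht0 _
  calc _ ≤ sampleLaw ρ t {z | ∃ f ∈ T,
        ε * (K + K + excessRisk ρ f) ≤ excessRisk ρ f - empExcessRisk ρ z f} := by
        refine measure_mono fun z => ?_
        rintro ⟨f, hf, hfz⟩
        refine ⟨f, hf, le_trans ?_ hfz⟩
        nlinarith [h.excessRisk_le hf]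
    _ ≤ _ := h.sampleLaw_deviation_le_of_one_le hB ht hK hK hε htθ
    _ ≤ _ := by
        refine mul_le_mul' le_rfl (ENNReal.ofReal_le_ofReal (Real.exp_le_exp.2 (neg_le_neg ?_)))
        have hB4 : 1 ≤ B ^ 4 := one_le_pow₀ hB
        have hpow : (t : ℝ) ^ (1 - 2 * d * θ) ≤ ε ^ 2 * t := by
          have h1 : ε ^ 2 * t = (t : ℝ) ^ (1 - 2 * θ) := by
            rw [hεdef, ← Real.rpow_natCast, ← Real.rpow_mul ht0.le, ← Real.rpow_add_one ht0.ne']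
            congr 1; push_cast; ring
          rw [h1]
          exact Real.rpow_le_rpow_of_exponent_le ht1 (by nlinarith)
        have hpw : 3 * B ^ 4 ≤ (3 * B ^ 4) ^ d := le_self_pow₀ (by linarith) (by omega)
        -- `(1 - ε) / (1 + ε) ≥ 1 / 3` as `ε < 1 / 2`
        calc K * (t : ℝ) ^ (1 - 2 * d * θ) / (214 * (3 * B ^ 4) ^ d)
            ≤ K * (ε ^ 2 * t) / (214 * (3 * B ^ 4)) := by gcongr
          _ ≤ ε ^ 2 * (1 - ε) * K * t / (214 * (1 + ε) * B ^ 4) := by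
              rw [div_le_div_iff₀ (by positivity) (by positivity)]
              have h2 : 0 ≤ K * (ε ^ 2 * t) * 214 * B ^ 4 := by positivity
              nlinarith

end

theorem summable_exp_neg_mul_rpow {a γ : ℝ} (ha : 0 < a) (hγ : 0 < γ) :
    Summable fun t : ℕ => Real.exp (-a * (t : ℝ) ^ γ) := by
  have h1 : Tendsto (fun t : ℕ => (t : ℝ) ^ γ) atTop atTop :=
    (tendsto_rpow_atTop hγ).comp tendsto_natCast_atTop_atTop
  have h2 := (isLittleO_exp_neg_mul_rpow_atTop ha (-2 / γ)).comp_tendsto h1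
  refine summable_of_isBigO_nat (Real.summable_nat_rpow.2 (by norm_num : (-2 : ℝ) < -1))
    (h2.isBigO.congr_right fun t => ?_)
  rw [Function.comp_apply, ← Real.rpow_mul (Nat.cast_nonneg t), mul_div_cancel₀ _ hγ.ne']

/-- Borel–Cantelli: if the covering numbers grow subexponentially, the tail bounds are summable in
the sample size. -/
theorem ae_eventually_deviation_le {c : ℝ} {d : ℕ} {B : ℝ} (hB : 1 ≤ B) (hd : 1 ≤ d) {θ : ℝ}
    (hθ : 0 < θ) (hθd : θ < 1 / (2 * d)) (n : ℕ → ℕ) (X : ∀ t, Set (TokenSeq c d (n t)))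
    (ρ : ∀ t, ProbabilityMeasure (TokenSeq c d (n t) × TokenSeq c d (n t)))
    (T : ∀ t, Set (TokenSeq c d (n t) → Mat d (n t)))
    (h : ∀ t, BoundedRegression B (X t) (ρ t) (T t))
    (hcov : ∀ δ : ℝ, 0 < δ → ∀ᶠ t : ℕ in atTop,
      supCoveringNumber t ((t : ℝ) ^ (-θ) / (20 * B)) (X t) (T t) ≤
        ENNReal.ofReal (Real.exp (δ * (t : ℝ) ^ (1 - 2 * d * θ))))
    {Ω : Type*} [MeasurableSpace Ω] (P : Measure Ω)
    (Z : ∀ t : ℕ, Ω → Fin t → TokenSeq c d (n t) × TokenSeq c d (n t))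
    (hZ : ∀ t, Measurable (Z t)) (hlaw : ∀ t, P.map (Z t) = sampleLaw (ρ t) t) :
    ∀ᵐ ω ∂P, ∀ᶠ t : ℕ in atTop, ∀ f ∈ T t,
      excessRisk (ρ t) f - empExcessRisk (ρ t) (Z t ω) f ≤
        (2 + 4 * B ^ 2) * (t : ℝ) ^ (-θ) := by
  have hdR : (0 : ℝ) < d := by exact_mod_cast hd
  set γ := 1 - 2 * d * θ with hγdef
  have hγ : 0 < γ := by
    rw [lt_div_iff₀ (by positivity)] at hθd
    linarith
  -- half of the exponent is spent on the covering numbers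
  set δ := 1 / (2 * (214 * (3 * B ^ 4) ^ d)) with hδdef
  have hδ : 0 < δ := by positivity
  have hsmall : ∀ᶠ t : ℕ in atTop, (t : ℝ) ^ (-θ) < 1 / 2 :=
    ((tendsto_rpow_neg_atTop hθ).comp tendsto_natCast_atTop_atTop).eventually_lt_const
      (by norm_num)
  obtain ⟨t₀, ht₀⟩ := eventually_atTop.1 ((hcov δ hδ).and (hsmall.and (eventually_ge_atTop 1)))
  let bad : ℕ → Set Ω := fun t => {ω | t₀ ≤ t ∧ ∃ f ∈ T t, (2 * 1 + 4 * B ^ 2) * (t : ℝ) ^ (-θ) ≤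
    excessRisk (ρ t) f - empExcessRisk (ρ t) (Z t ω) f}
  have hbad : ∀ t, P (bad t) ≤ ENNReal.ofReal (14 * Real.exp (-δ * (t : ℝ) ^ γ)) := fun t => by
    by_cases ht : t₀ ≤ t
    · obtain ⟨hN, hε, ht1⟩ := ht₀ t ht
      have hrate := (h t).sampleLaw_rate_le hB hd hθ one_pos ht1 hε
      rw [← hlaw t, one_mul] at hrate
      calc P (bad t) ≤ P (Z t ⁻¹' {z | ∃ f ∈ T t, (2 * 1 + 4 * B ^ 2) * (t : ℝ) ^ (-θ) ≤
              excessRisk (ρ t) f - empExcessRisk (ρ t) z f}) :=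
            measure_mono fun ω hω => hω.2
        _ ≤ _ := (Measure.le_map_apply (hZ t).aemeasurable _).trans hrate
        _ ≤ 14 * ENNReal.ofReal (Real.exp (δ * (t : ℝ) ^ γ)) *
              ENNReal.ofReal (Real.exp (-(1 * (t : ℝ) ^ γ / (214 * (3 * B ^ 4) ^ d)))) := by
            gcongr
        _ = _ := by
            rw [mul_assoc, ← ENNReal.ofReal_mul (Real.exp_pos _).le, ← Real.exp_add,
              ENNReal.ofReal_mul (by norm_num), ENNReal.ofReal_ofNat]
            congr 4
            rw [hδdef]
            field_simp
            ring
    · have : bad t = ∅ := Set.eq_empty_of_forall_notMem fun ω hω => ht hω.1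
      simp [this]
  have hsum : ∑' t, P (bad t) ≠ ⊤ :=
    ne_top_of_le_ne_top ((summable_exp_neg_mul_rpow hδ hγ).mul_left 14).tsum_ofReal_ne_top
      (ENNReal.tsum_le_tsum hbad)
  filter_upwards [ae_eventually_notMem hsum] with ω hω
  filter_upwards [hω, eventually_ge_atTop t₀] with t ht htt f hf
  by_contra hlt
  exact ht ⟨htt, f, hf, by linarith [not_le.1 hlt]⟩

theorem mainTheorem6 (c : ℝ) (hc : 0 < c) (d : ℕ) (B : ℝ) (hB : 1 ≤ B) :
    -- the exponential tail bound
    (∀ (n : ℕ) (X : Set (TokenSeq c d n))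
        (ρ : ProbabilityMeasure (TokenSeq c d n × TokenSeq c d n))
        (T : Set (TokenSeq c d n → Mat d n)), BoundedRegression B X ρ T →
      ∀ m : ℕ, 1 ≤ m → ∀ α β ε : ℝ, 0 < α → 0 < β → 0 < ε → ε < 1 / 2 →
        sampleLaw ρ m {z | ∃ f ∈ T,
            ε * (α + β + excessRisk ρ f) ≤ excessRisk ρ f - empExcessRisk ρ z f} ≤
          14 * supCoveringNumber m (β * ε / (20 * B)) X T *
            ENNReal.ofReal (Real.exp
              (-(ε ^ 2 * (1 - ε) * α * m / (214 * (1 + ε) * B ^ 4))))) ∧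
    -- the error at rate `t ^ (-θ)`, up to and including `θ = 1 / (2 * d)`
    (∀ (n : ℕ) (X : Set (TokenSeq c d n))
        (ρ : ProbabilityMeasure (TokenSeq c d n × TokenSeq c d n))
        (T : Set (TokenSeq c d n → Mat d n)), BoundedRegression B X ρ T →
      ∀ θ K : ℝ, 0 < θ → θ ≤ 1 / (2 * d) → 0 < K →
      ∀ t : ℕ, 1 ≤ t → (t : ℝ) ^ (-θ) < 1 / 2 →
        sampleLaw ρ t {z | ∃ f ∈ T,
            (2 * K + 4 * B ^ 2) * (t : ℝ) ^ (-θ) ≤ excessRisk ρ f - empExcessRisk ρ z f} ≤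
          14 * supCoveringNumber t (K * (t : ℝ) ^ (-θ) / (20 * B)) X T *
            ENNReal.ofReal (Real.exp
              (-(K * (t : ℝ) ^ (1 - 2 * d * θ) / (214 * (3 * B ^ 4) ^ d))))) ∧
    -- the almost sure rate; token number, law and class may vary with the sample size `t`
    (∀ θ : ℝ, 0 < θ → θ < 1 / (2 * d) →
      ∀ (n : ℕ → ℕ) (X : ∀ t, Set (TokenSeq c d (n t)))
        (ρ : ∀ t, ProbabilityMeasure (TokenSeq c d (n t) × TokenSeq c d (n t)))
        (T : ∀ t, Set (TokenSeq c d (n t) → Mat d (n t))),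
      (∀ t, BoundedRegression B (X t) (ρ t) (T t)) →
      (∀ δ : ℝ, 0 < δ → ∀ᶠ t : ℕ in atTop,
        supCoveringNumber t ((t : ℝ) ^ (-θ) / (20 * B)) (X t) (T t) ≤
          ENNReal.ofReal (Real.exp (δ * (t : ℝ) ^ (1 - 2 * d * θ)))) →
      ∀ (Ω : Type) (_ : MeasurableSpace Ω) (P : Measure Ω) (_ : IsProbabilityMeasure P)
        (Z : ∀ t : ℕ, Ω → Fin t → TokenSeq c d (n t) × TokenSeq c d (n t)),
      (∀ t, Measurable (Z t)) → (∀ t, P.map (Z t) = sampleLaw (ρ t) t) →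
        ∀ᵐ ω ∂P, ∀ᶠ t : ℕ in atTop, ∀ f ∈ T t,
          excessRisk (ρ t) f - empExcessRisk (ρ t) (Z t ω) f ≤
            (2 + 4 * B ^ 2) * (t : ℝ) ^ (-θ)) := by
  -- for `d = 0` the range `θ ≤ 1 / (2 * d) = 0` is empty
  have hd1 : ∀ θ : ℝ, 0 < θ → θ ≤ 1 / (2 * d) → 1 ≤ d := fun θ h0 h1 => by
    rcases Nat.eq_zero_or_pos d with rfl | hd
    · simp only [Nat.cast_zero, mul_zero, div_zero] at h1
      linarith
    · exact hd
  refine ⟨fun n X ρ T h m hm α β ε hα hβ hε hε2 => ?_, fun n X ρ T h θ K hθ hθd hK t ht htθ => ?_,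
    fun θ hθ hθd n X ρ T h hcov Ω _ P _ Z hZ hlaw => ?_⟩
  · exact h.sampleLaw_deviation_le_of_one_le hB hm hα hβ hε hε2
  · exact h.sampleLaw_rate_le hB (hd1 θ hθ hθd) hθ hK ht htθ
  · exact ae_eventually_deviation_le hB (hd1 θ hθ hθd.le) hθ hθd n X ρ T h hcov P Z hZ hlaw
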